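/- Let $n\ge 1$, let $\xi_n$ be a primitive $n$-th root of unity, $K=\mathbb{Q}(\xi_n)$, and let $a(k)$ be the number of non-zero ideals of norm $k$ in the ring of integers $\mathbb{Z}[\xi_n]$ of $K$ ($k\ge 1$), so that the Dedekind zeta function is $\zeta_K(s)=\sum_{k\ge 1}a(k)k^{-s}$ for $\operatorname{Re}(s)>1$. For a prime number $p$, the Euler factor of $\zeta_K$ at $p$ is $E_n(p^{-s})=\sum_{j\ge 0}a(p^j)p^{-js}$. Write $\phi$ for Euler's totient function. (1) For $\operatorname{Re}(s)>1$, the Dirichlet series of $\zeta_K$ converges absolutely and $\zeta_K(s)=\prod_p E_n(p^{-s})$, where $p$ runs over all prime numbers. (2) For each prime $p$ there are positive integers $\ell,m$ (depending on $p$ and $n$) such that, for all $s$ with $\operatorname{Re}(s)>1$, $$E_n(p^{-s})=\frac{1}{(1-p^{-\ell s})^{m}}=\sum_{j=0}^{\infty}\binom{j+m-1}{m-1}\frac{1}{(p^{s})^{\ell j}},$$ all series being convergent. Here $m$ is the number of prime ideals of $\mathbb{Z}[\xi_n]$ above $p$, and each of them has residue class degree $\ell$. If $p\nmid n$, then $\ell$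 is the multiplicative order of $p$ modulo $n$, and $\ell m=\phi(n)$. If $p\mid n$ and $n=r\,p^t$ with $t\ge 1$ and $p\nmid r$, then $\ell$ is the multiplicative order of $p$ modulo $r$, and $\ell m=\phi(r)$ (so $\ell=m=1$ if $r=1$). (3) Let $n$ be one of the following $29$ values (the non-trivial class number one cases without $n\equiv 2 \bmod 4$): $3$, $4$, $5$, $7$, $8$, $9$, $11$, $12$, $13$, $15$, $16$, $17$, $19$, $20$, $21$, $24$, $25$, $27$, $28$, $32$, $33$, $35$, $36$, $40$, $44$, $45$, $48$, $60$, $84$. Then $\ell$ and $m$ are as follows. (3a) Primes $p\nmid n$. In the table below, an entry $k_{\ell}$ in the row of $n$ means that all primes $p\equiv k \bmod n$ have this $\ell$ (which is the multiplicative order of $k$ modulo $n$) and $m=\phi(n)/\ell$. Each row lists exactly the residues $0<k<n$ coprime to $n$. $n=3$: $1_{1}$, $2_{2}$. $n=4$: $1_{1}$, $3_{2}$. $n=5$: $1_{1}$, $2_{4}$, $3_{4}$, $4_{2}$. $n=8$: $1_{1}$, $3_{2}$, $5_{2}$, $7_{2}$. $n=12$: $1_{1}$, $5_{2}$, $7_{2}$,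 $11_{2}$. $n=7$: $1_{1}$, $2_{3}$, $3_{6}$, $4_{3}$, $5_{6}$, $6_{2}$. $n=9$: $1_{1}$, $2_{6}$, $4_{3}$, $5_{6}$, $7_{3}$, $8_{2}$. $n=15$: $1_{1}$, $2_{4}$, $4_{2}$, $7_{4}$, $8_{4}$, $11_{2}$, $13_{4}$, $14_{2}$. $n=16$: $1_{1}$, $3_{4}$, $5_{4}$, $7_{2}$, $9_{2}$, $11_{4}$, $13_{4}$, $15_{2}$. $n=20$: $1_{1}$, $3_{4}$, $7_{4}$, $9_{2}$, $11_{2}$, $13_{4}$, $17_{4}$, $19_{2}$. $n=24$: $1_{1}$, $5_{2}$, $7_{2}$, $11_{2}$, $13_{2}$, $17_{2}$, $19_{2}$, $23_{2}$. $n=11$: $1_{1}$, $2_{10}$, $3_{5}$, $4_{5}$, $5_{5}$, $6_{10}$, $7_{10}$, $8_{10}$, $9_{5}$, $10_{2}$. $n=13$: $1_{1}$, $2_{12}$, $3_{3}$, $4_{6}$, $5_{4}$, $6_{12}$, $7_{12}$, $8_{4}$, $9_{3}$, $10_{6}$, $11_{12}$, $12_{2}$. $n=21$: $1_{1}$, $2_{6}$,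 $4_{3}$, $5_{6}$, $8_{2}$, $10_{6}$, $11_{6}$, $13_{2}$, $16_{3}$, $17_{6}$, $19_{6}$, $20_{2}$. $n=28$: $1_{1}$, $3_{6}$, $5_{6}$, $9_{3}$, $11_{6}$, $13_{2}$, $15_{2}$, $17_{6}$, $19_{6}$, $23_{6}$, $25_{3}$, $27_{2}$. $n=36$: $1_{1}$, $5_{6}$, $7_{6}$, $11_{6}$, $13_{3}$, $17_{2}$, $19_{2}$, $23_{6}$, $25_{3}$, $29_{6}$, $31_{6}$, $35_{2}$. $n=17$: $1_{1}$, $2_{8}$, $3_{16}$, $4_{4}$, $5_{16}$, $6_{16}$, $7_{16}$, $8_{8}$, $9_{8}$, $10_{16}$, $11_{16}$, $12_{16}$, $13_{4}$, $14_{16}$, $15_{8}$, $16_{2}$. $n=32$: $1_{1}$, $3_{8}$, $5_{8}$, $7_{4}$, $9_{4}$, $11_{8}$, $13_{8}$, $15_{2}$, $17_{2}$, $19_{8}$, $21_{8}$, $23_{4}$, $25_{4}$, $27_{8}$, $29_{8}$, $31_{2}$. $n=40$: $1_{1}$, $3_{4}$, $7_{4}$, $9_{2}$, $11_{2}$, $13_{4}$,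 $17_{4}$, $19_{2}$, $21_{2}$, $23_{4}$, $27_{4}$, $29_{2}$, $31_{2}$, $33_{4}$, $37_{4}$, $39_{2}$. $n=48$: $1_{1}$, $5_{4}$, $7_{2}$, $11_{4}$, $13_{4}$, $17_{2}$, $19_{4}$, $23_{2}$, $25_{2}$, $29_{4}$, $31_{2}$, $35_{4}$, $37_{4}$, $41_{2}$, $43_{4}$, $47_{2}$. $n=60$: $1_{1}$, $7_{4}$, $11_{2}$, $13_{4}$, $17_{4}$, $19_{2}$, $23_{4}$, $29_{2}$, $31_{2}$, $37_{4}$, $41_{2}$, $43_{4}$, $47_{4}$, $49_{2}$, $53_{4}$, $59_{2}$. $n=19$: $1_{1}$, $2_{18}$, $3_{18}$, $4_{9}$, $5_{9}$, $6_{9}$, $7_{3}$, $8_{6}$, $9_{9}$, $10_{18}$, $11_{3}$, $12_{6}$, $13_{18}$, $14_{18}$, $15_{18}$, $16_{9}$, $17_{9}$, $18_{2}$. $n=27$: $1_{1}$, $2_{18}$, $4_{9}$, $5_{18}$, $7_{9}$, $8_{6}$, $10_{3}$, $11_{18}$, $13_{9}$, $14_{18}$, $16_{9}$, $17_{6}$,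 $19_{3}$, $20_{18}$, $22_{9}$, $23_{18}$, $25_{9}$, $26_{2}$. $n=25$: $1_{1}$, $2_{20}$, $3_{20}$, $4_{10}$, $6_{5}$, $7_{4}$, $8_{20}$, $9_{10}$, $11_{5}$, $12_{20}$, $13_{20}$, $14_{10}$, $16_{5}$, $17_{20}$, $18_{4}$, $19_{10}$, $21_{5}$, $22_{20}$, $23_{20}$, $24_{2}$. $n=33$: $1_{1}$, $2_{10}$, $4_{5}$, $5_{10}$, $7_{10}$, $8_{10}$, $10_{2}$, $13_{10}$, $14_{10}$, $16_{5}$, $17_{10}$, $19_{10}$, $20_{10}$, $23_{2}$, $25_{5}$, $26_{10}$, $28_{10}$, $29_{10}$, $31_{5}$, $32_{2}$. $n=44$: $1_{1}$, $3_{10}$, $5_{5}$, $7_{10}$, $9_{5}$, $13_{10}$, $15_{10}$, $17_{10}$, $19_{10}$, $21_{2}$, $23_{2}$, $25_{5}$, $27_{10}$, $29_{10}$, $31_{10}$, $35_{10}$, $37_{5}$, $39_{10}$, $41_{10}$, $43_{2}$. $n=35$: $1_{1}$, $2_{12}$, $3_{12}$, $4_{6}$, $6_{2}$, $8_{4}$,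 $9_{6}$, $11_{3}$, $12_{12}$, $13_{4}$, $16_{3}$, $17_{12}$, $18_{12}$, $19_{6}$, $22_{4}$, $23_{12}$, $24_{6}$, $26_{6}$, $27_{4}$, $29_{2}$, $31_{6}$, $32_{12}$, $33_{12}$, $34_{2}$. $n=45$: $1_{1}$, $2_{12}$, $4_{6}$, $7_{12}$, $8_{4}$, $11_{6}$, $13_{12}$, $14_{6}$, $16_{3}$, $17_{4}$, $19_{2}$, $22_{12}$, $23_{12}$, $26_{2}$, $28_{4}$, $29_{6}$, $31_{3}$, $32_{12}$, $34_{6}$, $37_{4}$, $38_{12}$, $41_{6}$, $43_{12}$, $44_{2}$. $n=84$: $1_{1}$, $5_{6}$, $11_{6}$, $13_{2}$, $17_{6}$, $19_{6}$, $23_{6}$, $25_{3}$, $29_{2}$, $31_{6}$, $37_{3}$, $41_{2}$, $43_{2}$, $47_{6}$, $53_{6}$, $55_{2}$, $59_{6}$, $61_{6}$, $65_{6}$, $67_{6}$, $71_{2}$, $73_{6}$, $79_{6}$, $83_{2}$. (3b) Primes $p\mid n$. The following are all sextuples $(n,p,r,\phi(r),\ell,m)$, where $n$ is in the list, $p$ is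 a prime divisor of $n$, and $r$ is the largest divisor of $n$ that is not divisible by $p$; in each case $\ell m=\phi(r)$: $(3,3,1,1,1,1)$, $(4,2,1,1,1,1)$, $(5,5,1,1,1,1)$, $(8,2,1,1,1,1)$, $(12,2,3,2,2,1)$, $(12,3,4,2,2,1)$, $(7,7,1,1,1,1)$, $(9,3,1,1,1,1)$, $(15,3,5,4,4,1)$, $(15,5,3,2,2,1)$, $(16,2,1,1,1,1)$, $(20,2,5,4,4,1)$, $(20,5,4,2,1,2)$, $(24,2,3,2,2,1)$, $(24,3,8,4,2,2)$, $(11,11,1,1,1,1)$, $(13,13,1,1,1,1)$, $(21,3,7,6,6,1)$, $(21,7,3,2,1,2)$, $(28,2,7,6,3,2)$, $(28,7,4,2,2,1)$, $(36,2,9,6,6,1)$, $(36,3,4,2,2,1)$, $(17,17,1,1,1,1)$, $(32,2,1,1,1,1)$, $(40,2,5,4,4,1)$, $(40,5,8,4,2,2)$, $(48,2,3,2,2,1)$, $(48,3,16,8,4,2)$, $(60,2,15,8,4,2)$, $(60,3,20,8,4,2)$, $(60,5,12,4,2,2)$, $(19,19,1,1,1,1)$, $(27,3,1,1,1,1)$,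 $(25,5,1,1,1,1)$, $(33,3,11,10,5,2)$, $(33,11,3,2,2,1)$, $(44,2,11,10,10,1)$, $(44,11,4,2,2,1)$, $(35,5,7,6,6,1)$, $(35,7,5,4,4,1)$, $(45,3,5,4,4,1)$, $(45,5,9,6,6,1)$, $(84,2,21,12,6,2)$, $(84,3,28,12,6,2)$, $(84,7,12,4,2,2)$. -/

import Mathlib

open NumberField

noncomputable section

/-- The number of ideals of norm `k` in the ring of integers of `K`; for `k ≥ 1` this is the
`k`-th coefficient of the Dedekind zeta function of `K`. -/
def idealCount (K : Type*) [Field K] [NumberField K] (k : ℕ) : ℕ :=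
  Nat.card {I : Ideal (𝓞 K) // Ideal.absNorm I = k}

/-- The Euler factor at `p` of the Dedekind zeta function of `K`, evaluated at `s`: the part of
the Dirichlet series that is indexed by the powers of `p`, i.e. the power series with coefficients
`idealCount K (p ^ j)` at `p ^ (-s)`. -/
def eulerFactor (K : Type*) [Field K] [NumberField K] (p : ℕ) (s : ℂ) : ℂ :=
  ∑' j : ℕ, (idealCount K (p ^ j) : ℂ) * ((p : ℂ) ^ (-s)) ^ j

/-- The Euler factor at `p` of the Dedekind zeta function of `K` has the form
`(1 - p ^ (-ℓ s)) ^ (-m) = ∑ j, (j + m - 1).choose (m - 1) / (p ^ s) ^ (ℓ j)`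
with positive integers `ℓ` and `m`, for all `s` with real part larger than `1`. -/
structure HasEulerFactorForm (K : Type*) [Field K] [NumberField K] (p ℓ m : ℕ) : Prop where
  pos_left : 0 < ℓ
  pos_right : 0 < m
  summable : ∀ s : ℂ, 1 < s.re →
    Summable fun j : ℕ => (idealCount K (p ^ j) : ℂ) * ((p : ℂ) ^ (-s)) ^ j
  closed_form : ∀ s : ℂ, 1 < s.re →
    eulerFactor K p s = 1 / (1 - (p : ℂ) ^ (-((ℓ : ℂ) * s))) ^ m
  expansion : ∀ s : ℂ, 1 < s.re →
    HasSum (fun j : ℕ => (((j + m - 1).choose (m - 1) : ℕ) : ℂ) * (1 / ((p : ℂ) ^ s) ^ (ℓ * j)))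
      (eulerFactor K p s)

end

/-- The 29 values of `n` (with `n > 1` and `n` not congruent to `2` modulo `4`) for which the
`n`-th cyclotomic field has class number one. -/
def classNumberOneList : List ℕ :=
  [3, 4, 5, 7, 8, 9, 11, 12, 13, 15, 16, 17, 19, 20, 21, 24, 25, 27, 28, 32, 33, 35, 36, 40,
   44, 45, 48, 60, 84]

/-- Table of the unramified primes. A row `(n, [(k₁, ℓ₁), (k₂, ℓ₂), …])` means that the primes
congruent to `kᵢ` modulo `n` contribute via the basic index `p ^ ℓᵢ`. -/
def unramifiedTable : List (ℕ × List (ℕ × ℕ)) :=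
  [(3, [(1, 1), (2, 2)]),
   (4, [(1, 1), (3, 2)]),
   (5, [(1, 1), (2, 4), (3, 4), (4, 2)]),
   (8, [(1, 1), (3, 2), (5, 2), (7, 2)]),
   (12, [(1, 1), (5, 2), (7, 2), (11, 2)]),
   (7, [(1, 1), (2, 3), (3, 6), (4, 3), (5, 6), (6, 2)]),
   (9, [(1, 1), (2, 6), (4, 3), (5, 6), (7, 3), (8, 2)]),
   (15, [(1, 1), (2, 4), (4, 2), (7, 4), (8, 4), (11, 2), (13, 4), (14, 2)]),
   (16, [(1, 1), (3, 4), (5, 4), (7, 2), (9, 2), (11, 4), (13, 4), (15, 2)]),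
   (20, [(1, 1), (3, 4), (7, 4), (9, 2), (11, 2), (13, 4), (17, 4), (19, 2)]),
   (24, [(1, 1), (5, 2), (7, 2), (11, 2), (13, 2), (17, 2), (19, 2), (23, 2)]),
   (11, [(1, 1), (2, 10), (3, 5), (4, 5), (5, 5), (6, 10), (7, 10), (8, 10), (9, 5), (10, 2)]),
   (13, [(1, 1), (2, 12), (3, 3), (4, 6), (5, 4), (6, 12), (7, 12), (8, 4), (9, 3), (10, 6),
     (11, 12), (12, 2)]),
   (21, [(1, 1), (2, 6), (4, 3), (5, 6), (8, 2), (10, 6), (11, 6), (13, 2), (16, 3), (17, 6),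
     (19, 6), (20, 2)]),
   (28, [(1, 1), (3, 6), (5, 6), (9, 3), (11, 6), (13, 2), (15, 2), (17, 6), (19, 6), (23, 6),
     (25, 3), (27, 2)]),
   (36, [(1, 1), (5, 6), (7, 6), (11, 6), (13, 3), (17, 2), (19, 2), (23, 6), (25, 3), (29, 6),
     (31, 6), (35, 2)]),
   (17, [(1, 1), (2, 8), (3, 16), (4, 4), (5, 16), (6, 16), (7, 16), (8, 8), (9, 8), (10, 16),
     (11, 16), (12, 16), (13, 4), (14, 16), (15, 8), (16, 2)]),
   (32, [(1, 1), (3, 8), (5, 8), (7, 4), (9, 4), (11, 8), (13, 8), (15, 2), (17, 2), (19, 8),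
     (21, 8), (23, 4), (25, 4), (27, 8), (29, 8), (31, 2)]),
   (40, [(1, 1), (3, 4), (7, 4), (9, 2), (11, 2), (13, 4), (17, 4), (19, 2), (21, 2), (23, 4),
     (27, 4), (29, 2), (31, 2), (33, 4), (37, 4), (39, 2)]),
   (48, [(1, 1), (5, 4), (7, 2), (11, 4), (13, 4), (17, 2), (19, 4), (23, 2), (25, 2), (29, 4),
     (31, 2), (35, 4), (37, 4), (41, 2), (43, 4), (47, 2)]),
   (60, [(1, 1), (7, 4), (11, 2), (13, 4), (17, 4), (19, 2), (23, 4), (29, 2), (31, 2),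
     (37, 4), (41, 2), (43, 4), (47, 4), (49, 2), (53, 4), (59, 2)]),
   (19, [(1, 1), (2, 18), (3, 18), (4, 9), (5, 9), (6, 9), (7, 3), (8, 6), (9, 9), (10, 18),
     (11, 3), (12, 6), (13, 18), (14, 18), (15, 18), (16, 9), (17, 9), (18, 2)]),
   (27, [(1, 1), (2, 18), (4, 9), (5, 18), (7, 9), (8, 6), (10, 3), (11, 18), (13, 9),
     (14, 18), (16, 9), (17, 6), (19, 3), (20, 18), (22, 9), (23, 18), (25, 9), (26, 2)]),
   (25, [(1, 1), (2, 20), (3, 20), (4, 10), (6, 5), (7, 4), (8, 20), (9, 10), (11, 5),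
     (12, 20), (13, 20), (14, 10), (16, 5), (17, 20), (18, 4), (19, 10), (21, 5), (22, 20),
     (23, 20), (24, 2)]),
   (33, [(1, 1), (2, 10), (4, 5), (5, 10), (7, 10), (8, 10), (10, 2), (13, 10), (14, 10),
     (16, 5), (17, 10), (19, 10), (20, 10), (23, 2), (25, 5), (26, 10), (28, 10), (29, 10),
     (31, 5), (32, 2)]),
   (44, [(1, 1), (3, 10), (5, 5), (7, 10), (9, 5), (13, 10), (15, 10), (17, 10), (19, 10),
     (21, 2), (23, 2), (25, 5), (27, 10), (29, 10), (31, 10), (35, 10), (37, 5), (39, 10),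
     (41, 10), (43, 2)]),
   (35, [(1, 1), (2, 12), (3, 12), (4, 6), (6, 2), (8, 4), (9, 6), (11, 3), (12, 12), (13, 4),
     (16, 3), (17, 12), (18, 12), (19, 6), (22, 4), (23, 12), (24, 6), (26, 6), (27, 4), (29, 2),
     (31, 6), (32, 12), (33, 12), (34, 2)]),
   (45, [(1, 1), (2, 12), (4, 6), (7, 12), (8, 4), (11, 6), (13, 12), (14, 6), (16, 3),
     (17, 4), (19, 2), (22, 12), (23, 12), (26, 2), (28, 4), (29, 6), (31, 3), (32, 12), (34, 6),
     (37, 4), (38, 12), (41, 6), (43, 12), (44, 2)]),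
   (84, [(1, 1), (5, 6), (11, 6), (13, 2), (17, 6), (19, 6), (23, 6), (25, 3), (29, 2),
     (31, 6), (37, 3), (41, 2), (43, 2), (47, 6), (53, 6), (55, 2), (59, 6), (61, 6), (65, 6),
     (67, 6), (71, 2), (73, 6), (79, 6), (83, 2)])]

/-- The pair `(k, ℓ)` occurs in the row of `n` of the table of the unramified primes. -/
def InUnramifiedTable (n k ℓ : ℕ) : Prop :=
  ∃ row ∈ unramifiedTable, row.1 = n ∧ (k, ℓ) ∈ row.2

/-- Table of the ramified primes, with rows `(n, p, r, φ(r), ℓ, m)`, where `r` is the `p`-free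
part of `n`. -/
def ramifiedTable : List (ℕ × ℕ × ℕ × ℕ × ℕ × ℕ) :=
  [(3, 3, 1, 1, 1, 1), (4, 2, 1, 1, 1, 1), (5, 5, 1, 1, 1, 1), (8, 2, 1, 1, 1, 1),
   (12, 2, 3, 2, 2, 1), (12, 3, 4, 2, 2, 1), (7, 7, 1, 1, 1, 1), (9, 3, 1, 1, 1, 1),
   (15, 3, 5, 4, 4, 1), (15, 5, 3, 2, 2, 1), (16, 2, 1, 1, 1, 1), (20, 2, 5, 4, 4, 1),
   (20, 5, 4, 2, 1, 2), (24, 2, 3, 2, 2, 1), (24, 3, 8, 4, 2, 2), (11, 11, 1, 1, 1, 1),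
   (13, 13, 1, 1, 1, 1), (21, 3, 7, 6, 6, 1), (21, 7, 3, 2, 1, 2), (28, 2, 7, 6, 3, 2),
   (28, 7, 4, 2, 2, 1), (36, 2, 9, 6, 6, 1), (36, 3, 4, 2, 2, 1), (17, 17, 1, 1, 1, 1),
   (32, 2, 1, 1, 1, 1), (40, 2, 5, 4, 4, 1), (40, 5, 8, 4, 2, 2), (48, 2, 3, 2, 2, 1),
   (48, 3, 16, 8, 4, 2), (60, 2, 15, 8, 4, 2), (60, 3, 20, 8, 4, 2), (60, 5, 12, 4, 2, 2),
   (19, 19, 1, 1, 1, 1), (27, 3, 1, 1, 1, 1), (25, 5, 1, 1, 1, 1), (33, 3, 11, 10, 5, 2),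
   (33, 11, 3, 2, 2, 1), (44, 2, 11, 10, 10, 1), (44, 11, 4, 2, 2, 1), (35, 5, 7, 6, 6, 1),
   (35, 7, 5, 4, 4, 1), (45, 3, 5, 4, 4, 1), (45, 5, 9, 6, 6, 1), (84, 2, 21, 12, 6, 2),
   (84, 3, 28, 12, 6, 2), (84, 7, 12, 4, 2, 2)]

/-! An ideal `I` whose norm is a product `a * b` of coprime numbers splits uniquely as `(I + (a))(I
+ (b))`, so `idealCount` is multiplicative. The number of ideals of norm at most `x` is `O(x)`, so
the Dirichlet series converges absolutely for `Re s > 1`; together these give the Euler product.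

For the local factors, the cyclotomic field is Galois over `ℚ`, so all primes above `p` share one
inertia degree `ℓ`. If there are `m` of them, unique factorization identifies the ideals of norm `p
^ (ℓ * i)` with multisets of `i` such primes (`idealCount_pow_mul`), and no other powers of `p` are
norms. The factor is therefore the negative binomial series in `p ^ (-ℓ s)`. Decomposition of primes
in cyclotomic fields makes `ℓ` an order modulo the `p`-free part of `n`, and the tables become a
finite computation. -/

section IdealCount

/-! ### Multiplicativity, convergence and the Euler product. -/

variable (K : Type*) [Field K] [NumberField K]

/-- Since `a ∈ J₁`, the norm of `J₁` divides the norm of `(a)`, a power of `a`; likewise for `b`.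
Coprimality then separates the two factors of `a * b`. -/
theorem Ideal.absNorm_eq_of_absNorm_mul_of_mem {S : Type*} [CommRing S] [IsDedekindDomain S]
    [Module.Free ℤ S] [Module.Finite ℤ S] {J₁ J₂ : Ideal S} {a b : ℕ} (hab : a.Coprime b)
    (ha : (a : S) ∈ J₁) (hb : (b : S) ∈ J₂) (h : absNorm (J₁ * J₂) = a * b) :
    absNorm J₁ = a ∧ absNorm J₂ = b := by
  have key : ∀ (J : Ideal S) (c : ℕ), (c : S) ∈ J → absNorm J ∣ c ^ Module.finrank ℤ S := by
    intro J c hc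
    rw [← absNorm_span_natCast (S := S)]
    exact absNorm_dvd_absNorm_of_le ((Ideal.span_singleton_le_iff_mem J).mpr hc)
  rw [map_mul] at h
  have h1 : absNorm J₁ ∣ a :=
    (Nat.Coprime.coprime_dvd_left (key J₁ a ha) (hab.pow_left _)).dvd_of_dvd_mul_right
      (h ▸ dvd_mul_right _ _)
  have h2 : absNorm J₂ ∣ b :=
    (Nat.Coprime.coprime_dvd_left (key J₂ b hb) (hab.symm.pow_left _)).dvd_of_dvd_mul_left
      (h ▸ dvd_mul_left _ _)
  have h3 : a ∣ absNorm J₁ :=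
    (Nat.Coprime.coprime_dvd_right h2 hab).dvd_of_dvd_mul_right (h ▸ dvd_mul_right _ _)
  have h4 : b ∣ absNorm J₂ :=
    (Nat.Coprime.coprime_dvd_right h1 hab.symm).dvd_of_dvd_mul_left (h ▸ dvd_mul_left _ _)
  exact ⟨Nat.dvd_antisymm h1 h3, Nat.dvd_antisymm h2 h4⟩

theorem Ideal.span_natCast_sup_span_natCast_eq_top {S : Type*} [CommRing S] {a b : ℕ}
    (hab : a.Coprime b) : Ideal.span {(a : S)} ⊔ Ideal.span {(b : S)} = ⊤ :=
  (Ideal.isCoprime_span_singleton_iff _ _).mpr (by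
    simpa using (Nat.isCoprime_iff_coprime.mpr hab).map (Int.castRingHom S)) |>.sup_eq

/-- Write `(a) = J₁ A`. The left side is `J₁ (J₂ + A)`, and `J₂ + A` contains both `a` and `b`. This
recovers a factor from the product, which gives uniqueness of the splitting. -/
theorem Ideal.mul_sup_span_natCast_eq_left {S : Type*} [CommRing S] [IsDedekindDomain S]
    {J₁ J₂ : Ideal S} {a b : ℕ} (hab : a.Coprime b) (ha : (a : S) ∈ J₁) (hb : (b : S) ∈ J₂) :
    J₁ * J₂ ⊔ Ideal.span {(a : S)} = J₁ := by
  obtain ⟨A, hA⟩ := Ideal.dvd_span_singleton.mpr ha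
  have : J₂ ⊔ A = ⊤ := by
    rw [eq_top_iff, ← Ideal.span_natCast_sup_span_natCast_eq_top (S := S) hab.symm]
    refine sup_le_sup ((Ideal.span_singleton_le_iff_mem J₂).mpr hb) ?_
    rw [hA]
    exact Ideal.mul_le_right
  rw [hA, ← Ideal.mul_sup, this, Ideal.mul_top]

theorem Ideal.sup_span_natCast_mul_sup_span_natCast {S : Type*} [CommRing S]
    {I : Ideal S} {a b : ℕ} (hab : a.Coprime b) (h : ((a * b : ℕ) : S) ∈ I) :
    (I ⊔ Ideal.span {(a : S)}) * (I ⊔ Ideal.span {(b : S)}) = I := by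
  have h' : Ideal.span {(a : S)} * Ideal.span {(b : S)} ≤ I := by
    rw [Ideal.span_singleton_mul_span_singleton, Ideal.span_singleton_le_iff_mem]
    exact_mod_cast h
  apply le_antisymm
  · rw [Ideal.sup_mul, Ideal.mul_sup, Ideal.mul_sup]
    exact sup_le (sup_le Ideal.mul_le_left Ideal.mul_le_left) (sup_le Ideal.mul_le_right h')
  · have := Ideal.span_natCast_sup_span_natCast_eq_top (S := S) hab
    calc I = I * (Ideal.span {(b : S)} ⊔ Ideal.span {(a : S)}) := by
            rw [sup_comm, this, Ideal.mul_top]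
      _ ≤ _ := by
            rw [Ideal.mul_sup]
            refine sup_le (Ideal.mul_mono le_sup_left le_sup_right) ?_
            rw [mul_comm]
            exact Ideal.mul_mono le_sup_right le_sup_left

theorem idealCount_mul_of_coprime {a b : ℕ} (hab : a.Coprime b) :
    idealCount K (a * b) = idealCount K a * idealCount K b := by
  have mem : ∀ {c : ℕ} {I : Ideal (𝓞 K)}, Ideal.absNorm I = c → (c : 𝓞 K) ∈ I := by
    rintro _ I rfl
    exact Ideal.absNorm_mem I
  rw [idealCount, idealCount, idealCount, ← Nat.card_prod]
  symm
  refine Nat.card_congr (Equiv.ofBijective (fun J => ⟨J.1.1 * J.2.1, by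
    rw [map_mul, J.1.2, J.2.2]⟩) ⟨?_, ?_⟩)
  · rintro ⟨⟨I₁, h₁⟩, ⟨I₂, h₂⟩⟩ ⟨⟨J₁, k₁⟩, ⟨J₂, k₂⟩⟩ h
    have h : I₁ * I₂ = J₁ * J₂ := congrArg Subtype.val h
    have e₁ : I₁ = J₁ := by
      rw [← Ideal.mul_sup_span_natCast_eq_left hab (mem h₁) (mem h₂), h,
        Ideal.mul_sup_span_natCast_eq_left hab (mem k₁) (mem k₂)]
    have e₂ : I₂ = J₂ := by
      rw [← Ideal.mul_sup_span_natCast_eq_left hab.symm (mem h₂) (mem h₁), mul_comm, h, mul_comm,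
        Ideal.mul_sup_span_natCast_eq_left hab.symm (mem k₂) (mem k₁)]
    subst e₁ e₂
    rfl
  · rintro ⟨I, hI⟩
    have hI' := Ideal.sup_span_natCast_mul_sup_span_natCast hab (mem hI)
    have := Ideal.absNorm_eq_of_absNorm_mul_of_mem hab
      (Ideal.mem_sup_right (Ideal.mem_span_singleton_self _))
      (Ideal.mem_sup_right (Ideal.mem_span_singleton_self _)) (hI'.symm ▸ hI)
    exact ⟨⟨⟨_, this.1⟩, ⟨_, this.2⟩⟩, Subtype.ext hI'⟩

theorem idealCount_one : idealCount K 1 = 1 := by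
  simp [idealCount, Ideal.absNorm_eq_one_iff]

open Filter in
theorem lSeriesSummable_idealCount {s : ℂ} (hs : 1 < s.re) :
    LSeriesSummable (fun k => (idealCount K k : ℂ)) s := by
  -- It suffices that the partial sums are `O(n)`, which follows from the finite limit of (number of
  -- nonzero ideals of norm at most `x`) / `x`.
  have := LSeriesSummable_of_sum_norm_bigO_and_nonneg (r := 1) (s := s)
    (f := fun k => (idealCount K k : ℝ)) ?_ (fun _ => Nat.cast_nonneg _) zero_le_one hs
  · simpa using this
  have hlim := (NumberField.Ideal.tendsto_norm_le_div_atTop₀ K).comp tendsto_natCast_atTop_atTop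
  refine ((hlim.isBigO_one ℝ).mul (Asymptotics.isBigO_refl (fun n : ℕ => (n : ℝ)) atTop)).congr' ?_
    (by simp)
  filter_upwards [eventually_ne_atTop 0] with n hn
  have hn' : (n : ℝ) ≠ 0 := Nat.cast_ne_zero.mpr hn
  simp only [Function.comp_apply, Nat.cast_le, ← Nat.cast_sum]
  -- Adding 1 on both sides brings in the zero ideal: the count then runs over all ideals and the
  -- sum starts at `k = 0`.
  rw [div_mul_cancel₀ _ hn', Nat.cast_inj, ← add_left_inj 1,
    ← Ideal.card_norm_le_eq_card_norm_le_add_one,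
    show Finset.Icc 1 n = Finset.Ioc 0 n from Finset.Icc_succ_left_eq_Ioc _ _,
    show 1 = idealCount K 0 by simp [idealCount, Ideal.absNorm_eq_zero_iff],
    Finset.sum_Ioc_add_eq_sum_Icc n.zero_le]
  simp only [idealCount]
  rw [← Finset.card_preimage_eq_sum_card_image_eq
    (fun k _ ↦ Ideal.finite_setOfPred_absNorm_eq k)]
  simp [Set.coe_eq_subtype]

theorem hasProd_eulerFactor {s : ℂ} (hs : 1 < s.re) :
    HasProd (fun p : Nat.Primes => eulerFactor K p s) (dedekindZeta K s) := by
  -- `LSeries.term` vanishes at index 0, which discards the coefficient `idealCount K 0 = 1` of the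
  -- zero ideal.
  have H := EulerProduct.eulerProduct_hasProd
    (f := LSeries.term (fun k => (idealCount K k : ℂ)) s) ?_ ?_
    (lSeriesSummable_idealCount K hs).norm (LSeries.term_zero _ _)
  · rw [show dedekindZeta K s = ∑' k, LSeries.term (fun k => (idealCount K k : ℂ)) s k from rfl]
    convert H using 2 with p
    refine tsum_congr fun j => ?_
    rw [LSeries.term_of_ne_zero (pow_ne_zero _ p.2.ne_zero), Complex.cpow_neg, inv_pow,
      div_eq_mul_inv, Nat.cast_pow, ← Complex.natCast_cpow_natCast_mul, Complex.cpow_nat_mul]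
  · simp [LSeries.term_of_ne_zero, idealCount_one]
  · intro a b hab
    rcases eq_or_ne a 0 with rfl | ha
    · simp
    rcases eq_or_ne b 0 with rfl | hb
    · simp
    rw [LSeries.term_of_ne_zero (mul_ne_zero ha hb), LSeries.term_of_ne_zero ha,
      LSeries.term_of_ne_zero hb, idealCount_mul_of_coprime K hab, Nat.cast_mul, Nat.cast_mul,
      Complex.natCast_mul_natCast_cpow, mul_div_mul_comm]

end IdealCount

theorem Ideal.isMaximal_span_natCast_int {p : ℕ} (hp : p.Prime) :
    (Ideal.span {(p : ℤ)}).IsMaximal :=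
  ((Ideal.span_singleton_prime (by exact_mod_cast hp.ne_zero)).mpr
    (Nat.prime_iff_prime_int.mp hp)).isMaximal (by simpa using hp.ne_zero)

theorem Ideal.mem_primesOver_of_natCast_pow_mem {K : Type*} [Field K] {p : ℕ}
    (hp : p.Prime) {P : Ideal (𝓞 K)} [hP : P.IsPrime] {k : ℕ} (h : ((p ^ k : ℕ) : 𝓞 K) ∈ P) :
    P ∈ Ideal.primesOver (Ideal.span {(p : ℤ)}) (𝓞 K) := by
  have := Ideal.isMaximal_span_natCast_int hp
  refine ⟨hP, ⟨this.eq_of_le Ideal.IsPrime.ne_top' ?_⟩⟩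
  rw [Ideal.span_singleton_le_iff_mem, Ideal.mem_comap]
  rw [Nat.cast_pow] at h
  simpa using hP.mem_of_pow_mem _ h

/-! ### Ideals of `p`-power norm and the shape of the Euler factor. -/

section EulerFactorForm

variable {K : Type*} [Field K] [NumberField K] {p : ℕ}

theorem Ideal.absNorm_eq_pow_of_mem_primesOver (hp : p.Prime) {P : Ideal (𝓞 K)}
    (hP : P ∈ Ideal.primesOver (Ideal.span {(p : ℤ)}) (𝓞 K)) :
    Ideal.absNorm P = p ^ Ideal.inertiaDeg P ℤ := by
  have := hP.1
  have := hP.2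
  have := Ideal.isMaximal_span_natCast_int hp
  have : P.IsMaximal := Ideal.IsMaximal.of_liesOver_isMaximal P (Ideal.span {(p : ℤ)})
  rw [Ideal.absNorm_eq_pow_inertiaDeg' P hp, Ideal.inertiaDeg'_eq_inertiaDeg]

theorem Ideal.absNorm_multiset_prod_of_mem_primesOver (hp : p.Prime) {ℓ : ℕ}
    (hℓ : ∀ P ∈ Ideal.primesOver (Ideal.span {(p : ℤ)}) (𝓞 K), Ideal.inertiaDeg P ℤ = ℓ)
    {M : Multiset (Ideal (𝓞 K))}
    (hM : ∀ P ∈ M, P ∈ Ideal.primesOver (Ideal.span {(p : ℤ)}) (𝓞 K)) :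
    Ideal.absNorm M.prod = p ^ (ℓ * M.card) := by
  rw [map_multiset_prod, Multiset.map_congr rfl fun P hP =>
    (Ideal.absNorm_eq_pow_of_mem_primesOver hp (hM P hP)).trans (by rw [hℓ P (hM P hP)]),
    Multiset.map_const', Multiset.prod_replicate, ← pow_mul]

open UniqueFactorizationMonoid in
theorem Ideal.mem_primesOver_of_mem_normalizedFactors (hp : p.Prime) {I : Ideal (𝓞 K)} {k : ℕ}
    (hI : Ideal.absNorm I = p ^ k) {P : Ideal (𝓞 K)} (hP : P ∈ normalizedFactors I) :
    P ∈ Ideal.primesOver (Ideal.span {(p : ℤ)}) (𝓞 K) := by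
  have hI0 : I ≠ ⊥ := by
    rintro rfl
    rw [Ideal.absNorm_bot] at hI
    exact (pow_ne_zero k hp.ne_zero) hI.symm
  obtain ⟨hP₁, hP₂⟩ := (Ideal.mem_normalizedFactors_iff hI0).mp hP
  exact Ideal.mem_primesOver_of_natCast_pow_mem hp (k := k) (hI ▸ hP₂ (Ideal.absNorm_mem I))

open UniqueFactorizationMonoid in
/-- The ideals of norm `p ^ (ℓ * i)` are the products of `i` primes above `p`. -/
theorem idealCount_pow_mul (hp : p.Prime) {ℓ : ℕ} (hℓ0 : 0 < ℓ)
    (hℓ : ∀ P ∈ Ideal.primesOver (Ideal.span {(p : ℤ)}) (𝓞 K), Ideal.inertiaDeg P ℤ = ℓ) (i : ℕ) :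
    idealCount K (p ^ (ℓ * i)) =
      (Ideal.primesOver (Ideal.span {(p : ℤ)}) (𝓞 K)).ncard.multichoose i := by
  classical
  have := Ideal.isMaximal_span_natCast_int hp
  have : Fintype (Ideal.primesOver (Ideal.span {(p : ℤ)}) (𝓞 K)) :=
    (IsDedekindDomain.primesOver_finite _ _).fintype
  rw [← Nat.card_coe_set_eq, Nat.card_eq_fintype_card, ← Sym.card_sym_eq_multichoose,
    ← Nat.card_eq_fintype_card]
  have hp0 : Ideal.span {(p : ℤ)} ≠ ⊥ := by simpa using hp.ne_zero
  have hmem : ∀ (M : Multiset (Ideal.primesOver (Ideal.span {(p : ℤ)}) (𝓞 K))),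
      ∀ P ∈ M.map Subtype.val, P ∈ Ideal.primesOver (Ideal.span {(p : ℤ)}) (𝓞 K) := by
    intro M P hP
    obtain ⟨Q, _, rfl⟩ := Multiset.mem_map.mp hP
    exact Q.2
  symm
  refine Nat.card_congr (Equiv.ofBijective (fun M => ⟨(M.1.map Subtype.val).prod, ?_⟩) ⟨?_, ?_⟩)
  · rw [Ideal.absNorm_multiset_prod_of_mem_primesOver hp hℓ (hmem M.1), Multiset.card_map, M.2]
  · intro M N h
    have h : (M.1.map Subtype.val).prod = (N.1.map Subtype.val).prod := congrArg Subtype.val h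
    apply Subtype.ext
    apply Multiset.map_injective Subtype.val_injective
    -- Injectivity is unique factorization: the multiset is read off from its product.
    rw [← normalizedFactors_prod_of_prime
      fun P hP => Ideal.prime_of_mem_primesOver hp0 (hmem M.1 P hP), h,
      normalizedFactors_prod_of_prime
      fun P hP => Ideal.prime_of_mem_primesOver hp0 (hmem N.1 P hP)]
  · rintro ⟨I, hI⟩
    have hF := fun P hP => Ideal.mem_primesOver_of_mem_normalizedFactors hp hI (P := P) hP
    obtain ⟨M, hM⟩ : ∃ M : Multiset (Ideal.primesOver (Ideal.span {(p : ℤ)}) (𝓞 K)),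
        M.map Subtype.val = normalizedFactors I :=
      ⟨(normalizedFactors I).attach.map fun P => ⟨P.1, hF P.1 P.2⟩, by
        simp [Multiset.map_map]⟩
    have hI0 : I ≠ 0 := by
      rintro rfl
      rw [Ideal.zero_eq_bot, Ideal.absNorm_bot] at hI
      exact (pow_ne_zero _ hp.ne_zero) hI.symm
    have hprod : (M.map Subtype.val).prod = I := by
      rw [hM, prod_normalizedFactors_eq hI0, normalize_eq]
    refine ⟨⟨M, ?_⟩, Subtype.ext hprod⟩
    -- Comparing norms shows that `M` has exactly `i` elements; this uses `0 < ℓ`.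
    have := Ideal.absNorm_multiset_prod_of_mem_primesOver hp hℓ (hmem M)
    rw [hprod, hI, Multiset.card_map] at this
    exact (Nat.eq_of_mul_eq_mul_left hℓ0 (Nat.pow_right_injective hp.two_le this)).symm

open UniqueFactorizationMonoid in
theorem idealCount_pow_eq_zero_of_not_dvd (hp : p.Prime) {ℓ : ℕ}
    (hℓ : ∀ P ∈ Ideal.primesOver (Ideal.span {(p : ℤ)}) (𝓞 K), Ideal.inertiaDeg P ℤ = ℓ) {j : ℕ}
    (hj : ¬ ℓ ∣ j) : idealCount K (p ^ j) = 0 := by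
  rw [idealCount, Nat.card_eq_zero]
  refine Or.inl ⟨fun ⟨I, hI⟩ => hj ?_⟩
  have hI0 : I ≠ 0 := by
    rintro rfl
    rw [Ideal.zero_eq_bot, Ideal.absNorm_bot] at hI
    exact (pow_ne_zero _ hp.ne_zero) hI.symm
  have := Ideal.absNorm_multiset_prod_of_mem_primesOver hp hℓ
    fun P hP => Ideal.mem_primesOver_of_mem_normalizedFactors hp hI (P := P) hP
  rw [prod_normalizedFactors_eq hI0, normalize_eq, hI] at this
  exact ⟨_, Nat.pow_right_injective hp.two_le this⟩

theorem Complex.norm_natCast_cpow_neg_lt_one {s : ℂ} (hp : 1 < p) (hs : 0 < s.re) :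
    ‖(p : ℂ) ^ (-s)‖ < 1 := by
  rw [Complex.norm_natCast_cpow_of_pos (by omega)]
  exact Real.rpow_lt_one_of_one_lt_of_neg (by exact_mod_cast hp) (by simpa using hs)

theorem hasSum_idealCount_pow (hp : p.Prime) {ℓ m : ℕ} (hℓ0 : 0 < ℓ) (hm0 : 0 < m)
    (hm : (Ideal.primesOver (Ideal.span {(p : ℤ)}) (𝓞 K)).ncard = m)
    (hℓ : ∀ P ∈ Ideal.primesOver (Ideal.span {(p : ℤ)}) (𝓞 K), Ideal.inertiaDeg P ℤ = ℓ)
    {x : ℂ} (hx : ‖x‖ < 1) :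
    HasSum (fun j : ℕ => (((j + m - 1).choose (m - 1) : ℕ) : ℂ) * (x ^ ℓ) ^ j)
        (1 / (1 - x ^ ℓ) ^ m) ∧
      HasSum (fun j : ℕ => (idealCount K (p ^ j) : ℂ) * x ^ j) (1 / (1 - x ^ ℓ) ^ m) := by
  obtain ⟨k, rfl⟩ : ∃ k, m = k + 1 := ⟨m - 1, by omega⟩
  have hxℓ : ‖x ^ ℓ‖ < 1 := by
    rw [norm_pow]
    exact pow_lt_one₀ (norm_nonneg _) hx hℓ0.ne'
  have H := hasSum_choose_mul_geometric_of_norm_lt_one k hxℓ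
  refine ⟨by simpa using H, ?_⟩
  -- Only exponents `j = ℓ * i` contribute, so the sum is reindexed by `i`.
  rw [← (mul_right_injective₀ hℓ0.ne').hasSum_iff (g := fun i => ℓ * i)]
  · have h : ∀ i : ℕ, (idealCount K (p ^ (ℓ * i)) : ℂ) * x ^ (ℓ * i) =
        ((i + k).choose k : ℂ) * (x ^ ℓ) ^ i := fun i => by
      rw [idealCount_pow_mul hp hℓ0 hℓ, hm, Nat.multichoose_eq, pow_mul,
        show k + 1 + i - 1 = i + k by omega, Nat.choose_symm_add]
    simpa only [Function.comp_def, h] using H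
  · intro j hj
    rw [idealCount_pow_eq_zero_of_not_dvd hp hℓ fun ⟨i, hi⟩ => hj ⟨i, hi.symm⟩]
    simp

theorem hasEulerFactorForm_of_primesOver (hp : p.Prime) {ℓ m : ℕ}
    (hm : (Ideal.primesOver (Ideal.span {(p : ℤ)}) (𝓞 K)).ncard = m)
    (hℓ : ∀ P ∈ Ideal.primesOver (Ideal.span {(p : ℤ)}) (𝓞 K), Ideal.inertiaDeg P ℤ = ℓ) :
    HasEulerFactorForm K p ℓ m := by
  have := Ideal.isMaximal_span_natCast_int hp
  have hm0 : 0 < m := hm ▸ Nat.pos_of_ne_zero (IsDedekindDomain.primesOver_ncard_ne_zero _ _)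
  have hℓ0 : 0 < ℓ := by
    obtain ⟨P, hP⟩ := Set.nonempty_of_ncard_ne_zero (hm.trans_ne hm0.ne')
    have := hP.1
    exact hℓ P hP ▸ Ideal.inertiaDeg_pos P ℤ
  have H := fun (s : ℂ) (hs : 1 < s.re) => hasSum_idealCount_pow hp hℓ0 hm0 hm hℓ
    (Complex.norm_natCast_cpow_neg_lt_one hp.one_lt (zero_lt_one.trans hs))
  refine ⟨hℓ0, hm0, fun s hs => (H s hs).2.summable, fun s hs => ?_, fun s hs => ?_⟩
  · rw [eulerFactor, (H s hs).2.tsum_eq, ← Complex.cpow_nat_mul, mul_neg]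
  · rw [eulerFactor, (H s hs).2.tsum_eq]
    convert (H s hs).1 using 3 with j
    rw [Complex.cpow_neg, ← pow_mul, inv_pow, one_div]

end EulerFactorForm

/-! ### Splitting of primes in cyclotomic fields. -/

section Cyclotomic

variable (n : ℕ) [NeZero n] (K : Type*) [Field K] [NumberField K]
  [IsCyclotomicExtension {n} ℚ K]

theorem ncard_primesOver_mul_ramificationIdxIn_mul_inertiaDeg {p : ℕ} (hp : p.Prime)
    {P : Ideal (𝓞 K)} (hP : P ∈ Ideal.primesOver (Ideal.span {(p : ℤ)}) (𝓞 K)) :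
    (Ideal.primesOver (Ideal.span {(p : ℤ)}) (𝓞 K)).ncard *
      ((Ideal.span {(p : ℤ)}).ramificationIdxIn (𝓞 K) * Ideal.inertiaDeg P ℤ) = n.totient := by
  have := hP.1
  have := hP.2
  have := Ideal.isMaximal_span_natCast_int hp
  have : IsGalois ℚ K := IsCyclotomicExtension.isGalois {n} ℚ K
  rw [← Ideal.inertiaDegIn_eq_inertiaDeg (Ideal.span {(p : ℤ)}) P Gal(K/ℚ),
    Ideal.ncard_primesOver_mul_ramificationIdxIn_mul_inertiaDegIn _ (𝓞 K) Gal(K/ℚ),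
    IsGalois.card_aut_eq_finrank, IsCyclotomicExtension.Rat.finrank n K]

/-- The fundamental identity, with number of primes times ramification index times `ℓ` equal to
`φ(n)`, determines `ℓ * m`: the ramification index is 1 if `p ∤ n`, and `φ(p ^ t)` if `n = r * p ^
t`, where it cancels from `φ(n) = φ(p ^ t) φ(r)`. -/
theorem exists_hasEulerFactorForm_of_prime {p : ℕ} (hp : p.Prime) : ∃ ℓ m : ℕ,
      HasEulerFactorForm K p ℓ m ∧
      (Ideal.primesOver (Ideal.span {(p : ℤ)}) (𝓞 K)).ncard = m ∧
      (∀ P ∈ Ideal.primesOver (Ideal.span {(p : ℤ)}) (𝓞 K), Ideal.inertiaDeg P ℤ = ℓ) ∧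
      (¬ p ∣ n → ℓ = orderOf (p : ZMod n) ∧ ℓ * m = Nat.totient n) ∧
      (∀ r t : ℕ, 1 ≤ t → n = r * p ^ t → ¬ p ∣ r →
        ℓ = orderOf (p : ZMod r) ∧ ℓ * m = Nat.totient r) := by
  have : Fact p.Prime := ⟨hp⟩
  have := Ideal.isMaximal_span_natCast_int hp
  have : IsGalois ℚ K := IsCyclotomicExtension.isGalois {n} ℚ K
  obtain ⟨P, hP⟩ := Set.nonempty_of_ncard_ne_zero
    (IsDedekindDomain.primesOver_ncard_ne_zero (Ideal.span {(p : ℤ)}) (𝓞 K))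
  have := hP.1
  have := hP.2
  have hℓ : ∀ Q ∈ Ideal.primesOver (Ideal.span {(p : ℤ)}) (𝓞 K),
      Ideal.inertiaDeg Q ℤ = Ideal.inertiaDeg P ℤ := by
    intro Q hQ
    have := hQ.1
    have := hQ.2
    rw [← Ideal.inertiaDegIn_eq_inertiaDeg (Ideal.span {(p : ℤ)}) Q Gal(K/ℚ),
      Ideal.inertiaDegIn_eq_inertiaDeg (Ideal.span {(p : ℤ)}) P Gal(K/ℚ)]
  have hcard := ncard_primesOver_mul_ramificationIdxIn_mul_inertiaDeg n K hp hP
  refine ⟨Ideal.inertiaDeg P ℤ, _, hasEulerFactorForm_of_primesOver hp rfl hℓ, rfl, hℓ,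
    fun hpn => ?_, fun r t ht hn hpr => ?_⟩
  · rw [IsCyclotomicExtension.Rat.ramificationIdxIn_eq_of_not_dvd p K hpn, one_mul] at hcard
    exact ⟨IsCyclotomicExtension.Rat.inertiaDeg_eq_of_not_dvd p K P hpn, by rw [mul_comm, hcard]⟩
  · obtain ⟨k, rfl⟩ : ∃ k, t = k + 1 := ⟨t - 1, by omega⟩
    rw [mul_comm] at hn
    refine ⟨IsCyclotomicExtension.Rat.inertiaDeg_eq n K P hn hpr, ?_⟩
    have hcop : (p ^ (k + 1)).Coprime r := (hp.coprime_iff_not_dvd.mpr hpr).pow_left _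
    rw [IsCyclotomicExtension.Rat.ramificationIdxIn_eq n K hn hpr, hn, Nat.totient_mul hcop,
      Nat.totient_prime_pow_succ hp] at hcard
    have hpos : 0 < p ^ k * (p - 1) := by
      have := hp.two_le
      exact Nat.mul_pos (by positivity) (by omega)
    apply Nat.eq_of_mul_eq_mul_left hpos
    rw [← hcard]
    ring

end Cyclotomic

/-! ### Verification of the tables. -/

section Tables

/-- Turns the order into a bounded check on natural numbers. Writing `1 % n` also covers modulus 1,
which occurs in the ramified rows with `r = 1`. -/
theorem ZMod.orderOf_natCast_eq {n k ℓ : ℕ} (hℓ : 0 < ℓ) (h : k ^ ℓ % n = 1 % n)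
    (h' : ∀ d < ℓ, 0 < d → k ^ d % n ≠ 1 % n) : orderOf (k : ZMod n) = ℓ := by
  have key : ∀ d : ℕ, (k : ZMod n) ^ d = 1 ↔ k ^ d % n = 1 % n := by
    intro d
    have := ZMod.natCast_eq_natCast_iff (k ^ d) 1 n
    push_cast at this
    exact this
  refine (orderOf_eq_iff hℓ).mpr ⟨(key ℓ).mpr h, fun d hd hd0 => fun hk => ?_⟩
  exact h' d hd hd0 ((key d).mp hk)

theorem unramifiedTable_complete : ∀ n ∈ classNumberOneList, ∃ row ∈ unramifiedTable,
    row.1 = n ∧ ∀ k < n, k.Coprime n → ∃ e ∈ row.2, e.1 = k := by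
  decide +kernel

theorem unramifiedTable_correct : ∀ row ∈ unramifiedTable, ∀ e ∈ row.2,
    e.1 < row.1 ∧ e.1.Coprime row.1 ∧ 0 < e.2 ∧ e.1 ^ e.2 % row.1 = 1 % row.1 ∧
      (∀ d < e.2, 0 < d → e.1 ^ d % row.1 ≠ 1 % row.1) ∧ e.2 ∣ row.1.totient := by
  decide +kernel

theorem ramifiedTable_complete : ∀ n ∈ classNumberOneList, ∀ p < n + 1, p.Prime → p ∣ n →
    ∃ row ∈ ramifiedTable, row.1 = n ∧ row.2.1 = p := by
  decide +kernel

theorem ramifiedTable_correct : ∀ row ∈ ramifiedTable,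
    -- The bound 6 makes the search finite; the largest exponent needed is 5, for `32 = 2 ^ 5`.
    row.2.1.Prime ∧ (∃ t < 6, 1 ≤ t ∧ row.1 = row.2.2.1 * row.2.1 ^ t) ∧ ¬ row.2.1 ∣ row.2.2.1 ∧
      row.2.2.2.1 = row.2.2.1.totient ∧ row.2.2.2.2.1 * row.2.2.2.2.2 = row.2.2.2.1 ∧
      0 < row.2.2.2.2.1 ∧ row.2.1 ^ row.2.2.2.2.1 % row.2.2.1 = 1 % row.2.2.1 ∧
      ∀ d < row.2.2.2.2.1, 0 < d → row.2.1 ^ d % row.2.2.1 ≠ 1 % row.2.2.1 := by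
  decide +kernel

end Tables

theorem mainTheorem3 (n : ℕ) [NeZero n] (K : Type*) [Field K] [NumberField K]
    [IsCyclotomicExtension {n} ℚ K] :
    -- the Euler product of the Dedekind zeta function
    (∀ s : ℂ, 1 < s.re →
      LSeriesSummable (fun k => (idealCount K k : ℂ)) s ∧
      HasProd (fun p : Nat.Primes => eulerFactor K p s) (dedekindZeta K s)) ∧
    -- the form of the Euler factors
    (∀ p : ℕ, p.Prime → ∃ ℓ m : ℕ,
      HasEulerFactorForm K p ℓ m ∧
      (Ideal.primesOver (Ideal.span {(p : ℤ)}) (𝓞 K)).ncard = m ∧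
      (∀ P ∈ Ideal.primesOver (Ideal.span {(p : ℤ)}) (𝓞 K), Ideal.inertiaDeg P ℤ = ℓ) ∧
      (¬ p ∣ n → ℓ = orderOf (p : ZMod n) ∧ ℓ * m = Nat.totient n) ∧
      (∀ r t : ℕ, 1 ≤ t → n = r * p ^ t → ¬ p ∣ r →
        ℓ = orderOf (p : ZMod r) ∧ ℓ * m = Nat.totient r)) ∧
    -- the tables for the class number one cases
    (n ∈ classNumberOneList →
      (∀ k : ℕ, k < n → k.Coprime n → ∃ ℓ : ℕ, InUnramifiedTable n k ℓ) ∧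
      (∀ k ℓ : ℕ, InUnramifiedTable n k ℓ →
        k < n ∧ k.Coprime n ∧ ℓ = orderOf (k : ZMod n) ∧ ℓ ∣ Nat.totient n ∧
        ∀ p : ℕ, p.Prime → p ≡ k [MOD n] →
          HasEulerFactorForm K p ℓ (Nat.totient n / ℓ)) ∧
      (∀ p : ℕ, p.Prime → p ∣ n → ∃ r f ℓ m : ℕ, (n, p, r, f, ℓ, m) ∈ ramifiedTable) ∧
      (∀ p r f ℓ m : ℕ, (n, p, r, f, ℓ, m) ∈ ramifiedTable →
        p.Prime ∧ (∃ t : ℕ, 1 ≤ t ∧ n = r * p ^ t) ∧ ¬ p ∣ r ∧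
        f = Nat.totient r ∧ ℓ * m = f ∧ HasEulerFactorForm K p ℓ m)) := by
  refine ⟨fun s hs => ⟨lSeriesSummable_idealCount K hs, hasProd_eulerFactor K hs⟩,
    fun p hp => exists_hasEulerFactorForm_of_prime n K hp, fun hn => ⟨?_, ?_, ?_, ?_⟩⟩
  · intro k hk hkn
    obtain ⟨row, hrow, hr, h⟩ := unramifiedTable_complete n hn
    obtain ⟨⟨_, ℓ⟩, he, rfl⟩ := h k hk hkn
    exact ⟨ℓ, row, hrow, hr, he⟩
  · rintro k ℓ ⟨row, hrow, rfl, he⟩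
    obtain ⟨hk, hkn, hℓ, h₁, h₂, hdvd⟩ := unramifiedTable_correct row hrow _ he
    have hord := ZMod.orderOf_natCast_eq hℓ h₁ h₂
    refine ⟨hk, hkn, hord.symm, hdvd, fun p hp hpk => ?_⟩
    obtain ⟨ℓ', m, hform, -, -, h, -⟩ := exists_hasEulerFactorForm_of_prime row.1 K hp
    have hpn : ¬ p ∣ row.1 := hp.coprime_iff_not_dvd.mp (hpk.gcd_eq.trans hkn)
    obtain ⟨h₃, h₄⟩ := h hpn
    rw [(ZMod.natCast_eq_natCast_iff p k row.1).mpr hpk, hord] at h₃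
    subst h₃
    rwa [← h₄, Nat.mul_div_cancel_left _ hℓ]
  · intro p hp hpn
    obtain ⟨⟨_, _, r, f, ℓ, m⟩, h, rfl, rfl⟩ := ramifiedTable_complete n hn p
      (Nat.lt_succ_of_le (Nat.le_of_dvd (NeZero.pos n) hpn)) hp hpn
    exact ⟨r, f, ℓ, m, h⟩
  · intro p r f ℓ m h
    obtain ⟨hp, ⟨t, -, ht, hnt⟩, hpr, hf, hℓm, hℓ, h₁, h₂⟩ := ramifiedTable_correct _ h
    refine ⟨hp, ⟨t, ht, hnt⟩, hpr, hf, hℓm, ?_⟩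
    obtain ⟨ℓ', m', hform, -, -, -, h'⟩ := exists_hasEulerFactorForm_of_prime n K hp
    obtain ⟨h₃, h₄⟩ := h' r t ht hnt hpr
    rw [ZMod.orderOf_natCast_eq hℓ h₁ h₂] at h₃
    subst h₃
    -- With `ℓ` identified, `ℓ * m = φ(r)` leaves only one possible `m`.
    have : m' = m := Nat.eq_of_mul_eq_mul_left hℓ (h₄.trans (hf.symm.trans hℓm.symm))
    rwa [← this]
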